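/- Let $n\ge 1$. Let $B_n^+$ be the monoid of positive $n$-strand braids, i.e. the monoid generated by $\sigma_1,\dots,\sigma_{n-1}$ subject to $\sigma_i\sigma_j=\sigma_j\sigma_i$ for $|i-j|\ge 2$ and $\sigma_i\sigma_j\sigma_i=\sigma_j\sigma_i\sigma_j$ for $|i-j|=1$. Let $\Delta_1=1$ and $\Delta_m=\sigma_1\sigma_2\cdots\sigma_{m-1}\Delta_{m-1}$ for $m\ge2$. A simple $n$-braid is a (left) divisor of $\Delta_n$ in $B_n^+$. For a simple $n$-braid $x$ let $D_L(x)$ (resp. $D_R(x)$) be the set of all $i\in\{1,\dots,n-1\}$ such that $\sigma_i$ is a left (resp. right) divisor of $x$. A sequence $(x_1,\dots,x_d)$ of simple $n$-braids is normal if, for each $k$, $x_k$ is the greatest common left divisor of $\Delta_n$ and $x_kx_{k+1}\cdots x_d$. The normal form of a positive braid is the normal sequence with that product, completed on the right by infinitely many trivial factors $1$; the braid has degree at most $d$ if all factors after the $d$-th one are $1$. For $d\ge1$ and a simple $n$-braid $y$, let $b_{n,d}(y)$ be the number of positive $n$-braids of degree at most $d$ whose $d$-th factor is $y$. Let $M_n$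 be the matrix with rows and columns indexed by the simple $n$-braids whose $(x,y)$-entry is $1$ if $(x,y)$ is normal and $0$ otherwise. For $I,J\subseteq\{1,\dots,n-1\}$ let $a_{n,I,J}$ be the number of simple $n$-braids $x$ with $D_L(x)=I$ and $D_R(x)\supseteq J$, and let $M'_n$ be the $2^{n-1}\times 2^{n-1}$ matrix indexed by the subsets of $\{1,\dots,n-1\}$ with entries $(M'_n)_{I,J}=a_{n,I,J}$. Then the characteristic polynomials of $M_n$ and $M'_n$ coincide up to a power of $x$: there is an integer $k\ge 0$ such that $$\chi_{M_n}(x)=x^k\,\chi_{M'_n}(x).$$ Moreover, for every $d\ge1$, every $J\subseteq\{1,\dots,n-1\}$ and every simple $n$-braid $y$ with $D_L(y)=J$, $$b_{n,d}(y)=\bigl((1,1,\dots,1)\,{M'_n}^{\,d-1}\bigr)_J .$$ -/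

import Mathlib

/-- The defining relations of the monoid of positive `n`-strand braids. The generator `σ_{i+1}` of
the usual presentation (with `σ_1, …, σ_{n-1}`) is represented by `i : Fin (n - 1)`. -/
inductive BraidRel (n : ℕ) : FreeMonoid (Fin (n - 1)) → FreeMonoid (Fin (n - 1)) → Prop
  | far (i j : Fin (n - 1)) (h : 2 ≤ |(i : ℤ) - (j : ℤ)|) :
      BraidRel n (FreeMonoid.of i * FreeMonoid.of j) (FreeMonoid.of j * FreeMonoid.of i)
  | near (i j : Fin (n - 1)) (h : |(i : ℤ) - (j : ℤ)| = 1) :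
      BraidRel n (FreeMonoid.of i * FreeMonoid.of j * FreeMonoid.of i)
        (FreeMonoid.of j * FreeMonoid.of i * FreeMonoid.of j)

/-- The monoid `B_n^+` of positive `n`-strand braids. In this monoid Mathlib's `x ∣ y` means
`∃ z, y = x * z`, that is, `x` is a *left* divisor of `y`. -/
abbrev BraidMonoid (n : ℕ) : Type := PresentedMonoid (BraidRel n)

namespace BraidMonoid

/-- The generator `σ_{i+1}`. -/
def sigma (n : ℕ) (i : Fin (n - 1)) : BraidMonoid n := PresentedMonoid.of (BraidRel n) i

/-- `x` is a right divisor of `y`. -/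
def RightDvd {n : ℕ} (x y : BraidMonoid n) : Prop := ∃ z, y = z * x

/-- The word for `Δ_{m+1}` in the `m` generators `σ_1, …, σ_m`, given by
`Δ_1 = 1` and `Δ_{m+2} = σ_1 σ_2 ⋯ σ_{m+1} Δ_{m+1}`. -/
def deltaWord : (m : ℕ) → FreeMonoid (Fin m)
  | 0 => 1
  | m + 1 => FreeMonoid.ofList (List.finRange (m + 1)) * FreeMonoid.map Fin.castSucc (deltaWord m)

/-- The braid `Δ_n`. -/
def delta (n : ℕ) : BraidMonoid n := PresentedMonoid.mk (BraidRel n) (deltaWord (n - 1))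

/-- `g` is the greatest common left divisor of `x` and `y` (for left divisibility). -/
def IsLeftGcd {n : ℕ} (g x y : BraidMonoid n) : Prop :=
  g ∣ x ∧ g ∣ y ∧ ∀ z, z ∣ x → z ∣ y → z ∣ g

/-- The simple `n`-braids: the divisors of `Δ_n`. -/
def Simple (n : ℕ) : Type := {x : BraidMonoid n // x ∣ delta n}

/-- The length of a positive braid, i.e. the number of letters of any word representing it. -/
def length (n : ℕ) : BraidMonoid n →* Multiplicative ℕ :=
  PresentedMonoid.lift (fun _ => Multiplicative.ofAdd 1) (by
    intro a b h
    cases h <;> simp)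

theorem length_mk (n : ℕ) (w : FreeMonoid (Fin (n - 1))) :
    length n (PresentedMonoid.mk (BraidRel n) w) = Multiplicative.ofAdd w.toList.length := by
  induction w using FreeMonoid.inductionOn' with
  | one => rfl
  | of_mul x w ih =>
    rw [map_mul, map_mul, ih]
    change Multiplicative.ofAdd 1 * _ = _
    rw [← ofAdd_add]
    simp [add_comm]

instance instFiniteSimple (n : ℕ) : Finite (Simple n) := by
  have hfin : {l : List (Fin (n - 1)) | l.length ≤ (length n (delta n)).toAdd}.Finite :=
    List.finite_length_le _ _
  have himg := hfin.image
    (fun l => PresentedMonoid.mk (BraidRel n) (FreeMonoid.ofList l))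
  suffices hsub : {x : BraidMonoid n | x ∣ delta n} ⊆ _ from (himg.subset hsub).to_subtype
  rintro x ⟨z, hz⟩
  obtain ⟨w, rfl⟩ := PresentedMonoid.surjective_mk x
  refine ⟨w.toList, ?_, rfl⟩
  have h := congrArg (fun t => (length n t).toAdd) hz
  simp only [map_mul, length_mk, toAdd_mul, toAdd_ofAdd] at h
  change w.toList.length ≤ _
  omega

noncomputable instance instFintypeSimple (n : ℕ) : Fintype (Simple n) := Fintype.ofFinite _

noncomputable instance instDecidableEqSimple (n : ℕ) : DecidableEq (Simple n) :=
  Classical.decEq _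

/-- A sequence `(x_1, …, x_d)` of braids is normal if `x_k` is the greatest common left divisor of
`Δ_n` and `x_k x_{k+1} ⋯ x_d` for each `k`. (In particular all `x_k` are simple.) -/
def IsNormal {n : ℕ} (l : List (BraidMonoid n)) : Prop :=
  ∀ (k : ℕ) (hk : k < l.length), IsLeftGcd l[k] (delta n) (l.drop k).prod

/-- The sequence `x 0, x 1, …` is the normal form of `z`, regarded as unbounded on the right: it is
a normal sequence with product `z`, completed with trivial factors. The `d`-th factor of `z` in the
sense of counting from `1` is `x (d - 1)`. -/
def HasNormalForm {n : ℕ} (z : BraidMonoid n) (x : ℕ → BraidMonoid n) : Prop :=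
  ∃ r : ℕ, IsNormal ((List.range r).map x) ∧ ((List.range r).map x).prod = z ∧ ∀ k, r ≤ k → x k = 1

/-- `b_{n,d}(y)`, for `d ≥ 1`: the number of positive `n`-braids of degree at most `d` (all factors
of the normal form after the `d`-th one are trivial) whose `d`-th factor is `y`. -/
noncomputable def b (n d : ℕ) (y : Simple n) : ℕ :=
  Set.ncard {z : BraidMonoid n |
    ∃ x : ℕ → BraidMonoid n, HasNormalForm z x ∧ (∀ k, d ≤ k → x k = 1) ∧ x (d - 1) = y.1}

open Classical in
/-- `D_L(x)`: the set of the `i` such that `σ_i` is a left divisor of `x`. -/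
noncomputable def DL {n : ℕ} (x : Simple n) : Finset (Fin (n - 1)) :=
  Finset.univ.filter fun i => sigma n i ∣ x.1

open Classical in
/-- `D_R(x)`: the set of the `i` such that `σ_i` is a right divisor of `x`. -/
noncomputable def DR {n : ℕ} (x : Simple n) : Finset (Fin (n - 1)) :=
  Finset.univ.filter fun i => RightDvd (sigma n i) x.1

open Classical in
/-- The incidence matrix `M_n`, with entries indexed by simple `n`-braids. -/
noncomputable def M (n : ℕ) : Matrix (Simple n) (Simple n) ℤ :=
  Matrix.of fun x y => if IsNormal [x.1, y.1] then 1 else 0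

/-- `a_{n,I,J}`: the number of simple `n`-braids `x` with `D_L(x) = I` and `D_R(x) ⊇ J`. -/
noncomputable def a (n : ℕ) (I J : Finset (Fin (n - 1))) : ℕ :=
  Nat.card {x : Simple n // DL x = I ∧ J ⊆ DR x}

/-- The matrix `M'_n`, with entries indexed by sets of generator indices. -/
noncomputable def M' (n : ℕ) : Matrix (Finset (Fin (n - 1))) (Finset (Fin (n - 1))) ℤ :=
  Matrix.of fun I J => (a n I J : ℤ)

end BraidMonoid

/-! A pair of simple braids (x, y) is normal exactly when D_L(y) ⊆ D_R(x)
(`isNormal_pair_iff_subset`). So M = RL with R(x, J) = [J ⊆ D_R(x)] and L(I, y) = [D_L(y) = I],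
while LR = M'. The characteristic polynomials of RL and LR differ by a power of X, and it falls on
the side of M because there are at least 2^(n-1) simple braids.

For the count, normality is a condition on consecutive pairs (`isNormal_cons_cons`) and normal forms
are unique, so b_{n,d}(y) is the y-th column sum of M^(d-1). Since 1·L = 1 and L·M^e = M'^e·L, this
is the entry of 1·M'^(d-1) at D_L(y).

The criterion for pairs rests on two facts about positive braids. Left cancellation, with lcms of
generators (`cancelBelow`), lets two common divisors be joined inside the set of common divisors
(`exists_join`). And a braid divides Δ exactly when its length is the number of inversions of its
permutation (`dvd_delta_iff_reduced`), which gives the exchange property and forbids squares of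
generators in simple braids. -/

namespace BraidMonoid

variable {n : ℕ}

/-! ### Generators and length -/

/-- The generators with indices `i` and `j` satisfy the braid relation of length three. -/
def Near (i j : Fin (n - 1)) : Prop := (i : ℕ) + 1 = j ∨ (j : ℕ) + 1 = i

/-- The generators with indices `i` and `j` are distinct and commute. -/
def Far (i j : Fin (n - 1)) : Prop := (i : ℕ) + 2 ≤ j ∨ (j : ℕ) + 2 ≤ i

theorem near_iff_abs {i j : Fin (n - 1)} : Near i j ↔ |(i : ℤ) - (j : ℤ)| = 1 := by
  rw [abs_eq (by norm_num), Near]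
  omega

theorem far_iff_abs {i j : Fin (n - 1)} : Far i j ↔ 2 ≤ |(i : ℤ) - (j : ℤ)| := by
  rw [le_abs, Far]
  omega

theorem Near.symm {i j : Fin (n - 1)} (h : Near i j) : Near j i := Or.symm h

theorem Far.symm {i j : Fin (n - 1)} (h : Far i j) : Far j i := Or.symm h

theorem Near.ne {i j : Fin (n - 1)} (h : Near i j) : i ≠ j := by
  rintro rfl
  unfold Near at h
  omega

theorem Far.ne {i j : Fin (n - 1)} (h : Far i j) : i ≠ j := by
  rintro rfl
  unfold Far at h
  omega

theorem Far.not_near {i j : Fin (n - 1)} (h : Far i j) : ¬ Near i j := by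
  unfold Near Far at *
  omega

theorem eq_or_near_or_far (i j : Fin (n - 1)) : i = j ∨ Near i j ∨ Far i j := by
  unfold Near Far
  rw [Fin.ext_iff]
  omega

/-- The braid diagram is a path: distinct neighbours of `j` lie on opposite sides of it. -/
theorem Near.far_of_ne {i j k : Fin (n - 1)} (h : Near i j) (h' : Near j k) (hne : i ≠ k) :
    Far i k := by
  unfold Near Far at *
  rw [Ne, Fin.ext_iff] at hne
  omega

theorem sigma_mul_sigma_of_far {i j : Fin (n - 1)} (h : Far i j) :
    sigma n i * sigma n j = sigma n j * sigma n i :=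
  PresentedMonoid.mk_eq_mk_of_rel (BraidRel.far i j (far_iff_abs.1 h))

theorem sigma_mul_sigma_mul_sigma_of_near {i j : Fin (n - 1)} (h : Near i j) :
    sigma n i * (sigma n j * sigma n i) = sigma n j * (sigma n i * sigma n j) := by
  have := PresentedMonoid.mk_eq_mk_of_rel (BraidRel.near i j (near_iff_abs.1 h))
  simp only [map_mul, mul_assoc] at this
  exact this

theorem far_mul {i j : Fin (n - 1)} (h : Far i j) (x : BraidMonoid n) :
    sigma n i * (sigma n j * x) = sigma n j * (sigma n i * x) := by
  simp only [← mul_assoc, sigma_mul_sigma_of_far h]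

theorem near_mul {i j : Fin (n - 1)} (h : Near i j) (x : BraidMonoid n) :
    sigma n i * (sigma n j * (sigma n i * x)) = sigma n j * (sigma n i * (sigma n j * x)) := by
  simp only [← mul_assoc]
  rw [mul_assoc (sigma n i), sigma_mul_sigma_mul_sigma_of_near h, ← mul_assoc]

/-- The length of a positive braid, as a natural number. -/
def len (x : BraidMonoid n) : ℕ := (length n x).toAdd

@[simp] theorem len_one : len (1 : BraidMonoid n) = 0 := by simp [len]

@[simp] theorem len_mul (x y : BraidMonoid n) : len (x * y) = len x + len y := by simp [len]

@[simp] theorem len_sigma (i : Fin (n - 1)) : len (sigma n i) = 1 := rfl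

theorem eq_one_or_sigma_mul (x : BraidMonoid n) : x = 1 ∨ ∃ i y, x = sigma n i * y := by
  obtain ⟨w, rfl⟩ := PresentedMonoid.surjective_mk x
  induction w using FreeMonoid.inductionOn' with
  | one => exact .inl rfl
  | of_mul i w => exact .inr ⟨i, PresentedMonoid.mk _ w, map_mul _ _ _⟩

theorem eq_one_or_mul_sigma (x : BraidMonoid n) : x = 1 ∨ ∃ y i, x = y * sigma n i := by
  suffices ∀ L (x : BraidMonoid n), len x = L → x = 1 ∨ ∃ y i, x = y * sigma n i from
    this _ x rfl
  intro L
  induction L with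
  | zero =>
    intro x hx
    rcases eq_one_or_sigma_mul x with rfl | ⟨i, y, rfl⟩
    · exact .inl rfl
    · simp at hx
  | succ L ih =>
    intro x hx
    rcases eq_one_or_sigma_mul x with rfl | ⟨i, y, rfl⟩
    · exact .inl rfl
    · rcases ih y (by simp at hx; omega) with rfl | ⟨z, j, rfl⟩
      · exact .inr ⟨1, i, by simp⟩
      · exact .inr ⟨sigma n i * z, j, by rw [mul_assoc]⟩

theorem eq_one_of_len_eq_zero {x : BraidMonoid n} (h : len x = 0) : x = 1 := by
  rcases eq_one_or_sigma_mul x with rfl | ⟨i, y, rfl⟩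
  · rfl
  · simp at h

/-- Induction on positive braids, multiplying by generators on the right. -/
theorem induction_mul_sigma {p : BraidMonoid n → Prop} (one : p 1)
    (mul_sigma : ∀ x i, p x → p (x * sigma n i)) (x : BraidMonoid n) : p x := by
  suffices ∀ L (x : BraidMonoid n), len x = L → p x from this _ x rfl
  intro L
  induction L with
  | zero => intro x hx; rwa [eq_one_of_len_eq_zero hx]
  | succ L ih =>
    intro x hx
    rcases eq_one_or_mul_sigma x with rfl | ⟨y, i, rfl⟩
    · exact one
    · exact mul_sigma y i (ih y (by simpa using hx))

/-! ### Left cancellation and lcms of generators (Garside) -/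

open Classical in
/-- The complement of `σ_i` in the least common right multiple of `σ_i` and `σ_j`. -/
noncomputable def comp (i j : Fin (n - 1)) : BraidMonoid n :=
  if i = j then 1 else if Near i j then sigma n j * sigma n i else sigma n j

@[simp] theorem comp_self (i : Fin (n - 1)) : comp i i = 1 := by simp [comp]

theorem comp_of_near {i j : Fin (n - 1)} (h : Near i j) :
    comp i j = sigma n j * sigma n i := by simp [comp, h, h.ne]

theorem comp_of_far {i j : Fin (n - 1)} (h : Far i j) : comp i j = sigma n j := by
  simp [comp, h.not_near, h.ne]

theorem sigma_mul_comp (i j : Fin (n - 1)) :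
    sigma n i * comp i j = sigma n j * comp j i := by
  rcases eq_or_near_or_far i j with rfl | h | h
  · rfl
  · rw [comp_of_near h, comp_of_near h.symm, sigma_mul_sigma_mul_sigma_of_near h]
  · rw [comp_of_far h, comp_of_far h.symm, sigma_mul_sigma_of_far h]

/-- The left cancellation property, and the existence of least common multiples of generators, for
products of generators with elements of length less than `L`. -/
def CancelBelow (n L : ℕ) : Prop :=
  ∀ (i j : Fin (n - 1)) (x y : BraidMonoid n), len x < L → sigma n i * x = sigma n j * y →
    ∃ z, x = comp i j * z ∧ y = comp j i * z

namespace CancelBelow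

variable {L : ℕ} {i j k : Fin (n - 1)} {x y : BraidMonoid n}

theorem self (H : CancelBelow n L) (hx : len x < L) (h : sigma n i * x = sigma n i * y) :
    x = y := by
  obtain ⟨z, rfl, rfl⟩ := H i i x y hx h
  rfl

theorem far (H : CancelBelow n L) (hij : Far i j) (hx : len x < L)
    (h : sigma n i * x = sigma n j * y) : ∃ z, x = sigma n j * z ∧ y = sigma n i * z := by
  obtain ⟨z, rfl, rfl⟩ := H i j x y hx h
  exact ⟨z, by rw [comp_of_far hij], by rw [comp_of_far hij.symm]⟩

theorem near (H : CancelBelow n L) (hij : Near i j) (hx : len x < L)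
    (h : sigma n i * x = sigma n j * y) :
    ∃ z, x = sigma n j * (sigma n i * z) ∧ y = sigma n i * (sigma n j * z) := by
  obtain ⟨z, rfl, rfl⟩ := H i j x y hx h
  exact ⟨z, by rw [comp_of_near hij, mul_assoc], by rw [comp_of_near hij.symm, mul_assoc]⟩

/-- The case of the cube condition in which `σ_k` braids with `σ_i` and commutes with `σ_j`. -/
theorem cube_near_far (H : CancelBelow n L) (hik : Near i k) (hkj : Far k j) (hij : i ≠ j)
    (hL : len (comp k i * x) ≤ L) (h : comp k i * x = comp k j * y) :
    ∃ z, comp i k * x = comp i j * z ∧ comp j k * y = comp j i * z := by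
  rw [comp_of_near hik.symm, len_mul, len_mul, len_sigma, len_sigma] at hL
  rw [comp_of_near hik.symm, comp_of_far hkj, mul_assoc] at h
  rw [comp_of_near hik, comp_of_far hkj.symm, mul_assoc]
  rcases eq_or_near_or_far i j with rfl | hij | hij
  · exact absurd rfl hij
  · obtain ⟨d, hd, rfl⟩ := H.near hij (by simp; omega) h
    obtain ⟨e, rfl, he⟩ := H.far hkj (by omega) hd
    have hlen := congrArg len hd
    simp only [len_mul, len_sigma] at hlen hL
    obtain ⟨f, rfl, rfl⟩ := H.near hik (by omega) he
    refine ⟨sigma n k * (sigma n i * (sigma n j * f)), ?_, ?_⟩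
    · rw [comp_of_near hij, mul_assoc, near_mul hij, far_mul hkj, far_mul hkj.symm f,
        near_mul hik.symm]
    · rw [comp_of_near hij.symm, mul_assoc, far_mul hkj.symm, near_mul hik.symm, near_mul hij,
        far_mul hkj]
  · obtain ⟨d, hd, rfl⟩ := H.far hij (by simp; omega) h
    obtain ⟨e, rfl, rfl⟩ := H.far hkj (by omega) hd
    refine ⟨sigma n k * (sigma n i * e), ?_, ?_⟩
    · rw [comp_of_far hij, far_mul hij, far_mul hkj]
    · rw [comp_of_far hij.symm, near_mul hik.symm]

/-- The cube condition for the complements of the generators. -/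
theorem cube (H : CancelBelow n L) (hL : len (comp k i * x) ≤ L)
    (h : comp k i * x = comp k j * y) :
    ∃ z, comp i k * x = comp i j * z ∧ comp j k * y = comp j i * z := by
  rcases eq_or_ne i j with rfl | hij
  · refine ⟨comp i k * x, by simp, ?_⟩
    suffices x = y by simp [this]
    rcases eq_or_near_or_far k i with rfl | hk | hk
    · simpa using h
    · rw [comp_of_near hk, mul_assoc, mul_assoc] at h
      simp only [comp_of_near hk, len_mul, len_sigma] at hL
      exact H.self (by omega) (H.self (by simp; omega) h)
    · rw [comp_of_far hk] at h
      simp only [comp_of_far hk, len_mul, len_sigma] at hL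
      exact H.self (by omega) h
  rcases eq_or_near_or_far i k with rfl | hik | hik
  · exact ⟨y, by simpa using h, rfl⟩
  · rcases eq_or_near_or_far k j with rfl | hkj | hkj
    · exact ⟨x, rfl, by simpa using h.symm⟩
    · have hfar := hik.far_of_ne hkj hij
      rw [comp_of_near hik.symm, len_mul, len_mul, len_sigma, len_sigma] at hL
      rw [comp_of_near hik.symm, comp_of_near hkj, mul_assoc, mul_assoc] at h
      have hlen := congrArg len h
      simp only [len_mul, len_sigma] at hlen
      obtain ⟨d, hx, hy⟩ := H.far hfar (by simp; omega) h
      obtain ⟨e, rfl, hd⟩ := H.near hkj (by omega) hx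
      obtain ⟨f, rfl, hd'⟩ := H.near hik.symm (by omega) hy
      have hlen' := congrArg len hd'
      simp only [len_mul, len_sigma] at hlen hlen' hL
      -- Both expressions for `d` begin with `σ_k`; cancelling it leaves `σ_j e = σ_i f`.
      obtain ⟨g, rfl, rfl⟩ := H.far hfar.symm (by omega)
        (H.self (by simp; omega) (hd.symm.trans hd'))
      refine ⟨sigma n k * (sigma n j * (sigma n i * (sigma n k * g))), ?_, ?_⟩
      · rw [comp_of_near hik, comp_of_far hfar, mul_assoc, far_mul hfar, near_mul hik,
          near_mul hkj]
      · rw [comp_of_near hkj.symm, comp_of_far hfar.symm, mul_assoc, far_mul hfar.symm,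
          near_mul hkj.symm, near_mul hik.symm, far_mul hfar]
    · exact H.cube_near_far hik hkj hij hL h
  · rcases eq_or_near_or_far k j with rfl | hkj | hkj
    · exact ⟨x, rfl, by simpa using h.symm⟩
    · obtain ⟨z, hz, hz'⟩ := H.cube_near_far hkj.symm hik.symm hij.symm (h ▸ hL) h.symm
      exact ⟨z, hz', hz⟩
    · simp only [comp_of_far hik.symm, len_mul, len_sigma] at hL
      rw [comp_of_far hik.symm, comp_of_far hkj] at h
      rw [comp_of_far hik, comp_of_far hkj.symm]
      rcases eq_or_near_or_far i j with rfl | hij | hij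
      · exact absurd rfl hij
      · obtain ⟨z, rfl, rfl⟩ := H.near hij (by omega) h
        refine ⟨sigma n k * z, ?_, ?_⟩
        · rw [comp_of_near hij, mul_assoc, far_mul hkj, far_mul hik.symm]
        · rw [comp_of_near hij.symm, mul_assoc, far_mul hik.symm, far_mul hkj]
      · obtain ⟨z, rfl, rfl⟩ := H.far hij (by omega) h
        refine ⟨sigma n k * z, ?_, ?_⟩
        · rw [comp_of_far hij, far_mul hkj]
        · rw [comp_of_far hij.symm, far_mul hik.symm]

end CancelBelow

/-- One application of a defining relation inside a word. -/
inductive Step (n : ℕ) : FreeMonoid (Fin (n - 1)) → FreeMonoid (Fin (n - 1)) → Prop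
  | mk (p q : FreeMonoid (Fin (n - 1))) {a b : FreeMonoid (Fin (n - 1))} (h : BraidRel n a b) :
      Step n (p * a * q) (p * b * q)

theorem Step.mul_left {u v : FreeMonoid (Fin (n - 1))} (h : Step n u v)
    (w : FreeMonoid (Fin (n - 1))) : Step n (w * u) (w * v) := by
  obtain ⟨p, q, h⟩ := h
  simpa [mul_assoc] using Step.mk (w * p) q h

theorem Step.mul_right {u v : FreeMonoid (Fin (n - 1))} (h : Step n u v)
    (w : FreeMonoid (Fin (n - 1))) : Step n (u * w) (v * w) := by
  obtain ⟨p, q, h⟩ := h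
  simpa [mul_assoc] using Step.mk p (q * w) h

theorem braidRel_symm {u v : FreeMonoid (Fin (n - 1))} (h : BraidRel n u v) : BraidRel n v u := by
  cases h with
  | far i j h => exact .far j i (by rwa [abs_sub_comm])
  | near i j h => exact .near j i (by rwa [abs_sub_comm])

theorem Step.symm {u v : FreeMonoid (Fin (n - 1))} (h : Step n u v) : Step n v u := by
  obtain ⟨p, q, h⟩ := h
  exact .mk p q (braidRel_symm h)

/-- Reduces equality of braids to single moves on words, along which the first letter can be
followed. -/
theorem reflTransGen_step_of_mk_eq {u v : FreeMonoid (Fin (n - 1))}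
    (h : PresentedMonoid.mk (BraidRel n) u = PresentedMonoid.mk (BraidRel n) v) :
    Relation.ReflTransGen (Step n) u v := by
  rw [PresentedMonoid.mk_eq_mk_iff] at h
  change ConGen.Rel (BraidRel n) u v at h
  induction h with
  | of u v h => exact .single (by simpa using Step.mk 1 1 h)
  | refl => exact .refl
  | symm _ ih =>
    have : Std.Symm (Step n) := ⟨fun _ _ h => h.symm⟩
    exact Std.Symm.symm _ _ ih
  | trans _ _ ih ih' => exact ih.trans ih'
  | mul _ _ ih ih' =>
    exact (ih.lift (· * _) fun _ _ h => h.mul_right _).trans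
      (ih'.lift (_ * ·) fun _ _ h => h.mul_left _)

theorem of_mul_inj {α : Type*} {i j : α} {u v : FreeMonoid α} :
    FreeMonoid.of i * u = FreeMonoid.of j * v ↔ i = j ∧ u = v :=
  List.cons.injEq i u j v ▸ Iff.rfl

/-- A step between nonempty words either takes place behind the first letter or changes it. -/
theorem Step.of_mul {k : Fin (n - 1)} {u v : FreeMonoid (Fin (n - 1))}
    (h : Step n (FreeMonoid.of k * u) v) :
    ∃ j w q, v = FreeMonoid.of j * w ∧ PresentedMonoid.mk (BraidRel n) u = comp k j * q ∧
      PresentedMonoid.mk (BraidRel n) w = comp j k * q := by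
  generalize hu : FreeMonoid.of k * u = u' at h
  obtain ⟨p, q, h⟩ := h
  cases p using FreeMonoid.casesOn with
  | one =>
    rw [one_mul] at hu ⊢
    cases h with
    | far i j h =>
      rw [mul_assoc, of_mul_inj] at hu
      obtain ⟨rfl, rfl⟩ := hu
      rw [← far_iff_abs] at h
      exact ⟨j, _, PresentedMonoid.mk _ q, mul_assoc _ _ _, by rw [comp_of_far h]; exact map_mul _ _ _,
        by rw [comp_of_far h.symm]; exact map_mul _ _ _⟩
    | near i j h =>
      rw [mul_assoc, mul_assoc, of_mul_inj] at hu
      obtain ⟨rfl, rfl⟩ := hu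
      rw [← near_iff_abs] at h
      refine ⟨j, FreeMonoid.of k * (FreeMonoid.of j * q), PresentedMonoid.mk _ q,
        by simp only [mul_assoc], ?_, ?_⟩
      · rw [comp_of_near h, mul_assoc, map_mul, map_mul]; rfl
      · rw [comp_of_near h.symm, mul_assoc, map_mul, map_mul]; rfl
  | of_mul j p =>
    rw [mul_assoc, mul_assoc, of_mul_inj] at hu
    obtain ⟨rfl, rfl⟩ := hu
    refine ⟨k, _, PresentedMonoid.mk _ (p * (_ * q)), by rw [mul_assoc, mul_assoc],
      by rw [comp_self, one_mul], ?_⟩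
    rw [comp_self, one_mul]
    simp only [map_mul, PresentedMonoid.mk_eq_mk_of_rel h]

/-- Induct on the length bound. Along a chain of moves from `σ_i u`, each word reached has a first
letter `σ_j` and a rest that completes the lcm of `σ_i` and `σ_j` with the same cofactor as `u`. The
next move may change `σ_j` to another letter, and the cube condition for shorter braids composes the
two lcms. -/
theorem cancelBelow (n L : ℕ) : CancelBelow n L := by
  induction L with
  | zero => intro i j x y h; exact absurd h (by omega)
  | succ L ih =>
    intro i j x y hx h
    obtain ⟨u, rfl⟩ := PresentedMonoid.surjective_mk x
    obtain ⟨v, rfl⟩ := PresentedMonoid.surjective_mk y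
    have hchain : Relation.ReflTransGen (Step n) (FreeMonoid.of i * u) (FreeMonoid.of j * v) :=
      reflTransGen_step_of_mk_eq (by rw [map_mul, map_mul]; exact h)
    clear h
    suffices ∀ w, Relation.ReflTransGen (Step n) (FreeMonoid.of i * u) w →
        ∃ j v z, w = FreeMonoid.of j * v ∧ PresentedMonoid.mk (BraidRel n) u = comp i j * z ∧
          PresentedMonoid.mk (BraidRel n) v = comp j i * z by
      obtain ⟨j', v', z, hw, hu, hv⟩ := this _ hchain
      obtain ⟨rfl, rfl⟩ := of_mul_inj.1 hw
      exact ⟨z, hu, hv⟩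
    intro w hw
    induction hw with
    | refl => exact ⟨i, u, PresentedMonoid.mk _ u, rfl, by simp, by simp⟩
    | tail _ hstep ih' =>
      obtain ⟨k, w', c, rfl, hu, hw'⟩ := ih'
      obtain ⟨l, v', q, rfl, hw'', hv'⟩ := hstep.of_mul
      -- The two complements have equal length, so the rest of the word keeps the length of `u` and
      -- the bound `L` stays available.
      have hlen : len (PresentedMonoid.mk (BraidRel n) u) =
          len (PresentedMonoid.mk (BraidRel n) w') := by
        have := congrArg len (sigma_mul_comp i k)
        simp only [len_mul, len_sigma] at this
        rw [hu, hw', len_mul, len_mul]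
        omega
      obtain ⟨z, hz, hz'⟩ := ih.cube (k := k) (i := i) (j := l) (by rw [← hw', ← hlen]; omega)
        (hw'.symm.trans hw'')
      exact ⟨l, v', z, rfl, hu.trans hz, hv'.trans hz'⟩

theorem exists_eq_comp_mul {i j : Fin (n - 1)} {x y : BraidMonoid n}
    (h : sigma n i * x = sigma n j * y) : ∃ z, x = comp i j * z ∧ y = comp j i * z :=
  cancelBelow n (len x + 1) i j x y (Nat.lt_succ_self _) h

theorem mul_left_cancel' (x : BraidMonoid n) {y z : BraidMonoid n} (h : x * y = x * z) :
    y = z := by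
  induction x using induction_mul_sigma generalizing y z with
  | one => simpa using h
  | mul_sigma x i ih =>
    rw [mul_assoc, mul_assoc] at h
    exact (cancelBelow n _).self (Nat.lt_succ_self _) (ih h)

theorem mul_dvd_mul_left_iff' {x y z : BraidMonoid n} : x * y ∣ x * z ↔ y ∣ z := by
  refine ⟨?_, mul_dvd_mul_left x⟩
  rintro ⟨w, hw⟩
  rw [mul_assoc] at hw
  exact ⟨w, mul_left_cancel' x hw⟩

theorem len_le_of_dvd {x y : BraidMonoid n} (h : x ∣ y) : len x ≤ len y := by
  obtain ⟨z, rfl⟩ := h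
  simp

theorem dvd_antisymm' {x y : BraidMonoid n} (h : x ∣ y) (h' : y ∣ x) : x = y := by
  obtain ⟨z, rfl⟩ := h
  have := len_le_of_dvd h'
  rw [len_mul] at this
  rw [eq_one_of_len_eq_zero (x := z) (by omega), mul_one]

theorem mul_sigma_mul_comp_dvd {p m : BraidMonoid n} {i j : Fin (n - 1)}
    (hi : p * sigma n i ∣ m) (hj : p * sigma n j ∣ m) : p * (sigma n i * comp i j) ∣ m := by
  obtain ⟨u, hu⟩ := hi
  obtain ⟨v, hv⟩ := hj
  rw [mul_assoc] at hu hv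
  obtain ⟨z, rfl, -⟩ := exists_eq_comp_mul (mul_left_cancel' p (hu.symm.trans hv))
  exact ⟨z, by rw [hu]; simp only [mul_assoc]⟩

/-- Two common left divisors of `m` and `m'` that are multiples of `p` have a common multiple that
is a common left divisor of `m` and `m'`. -/
theorem exists_join {m m' p x y : BraidMonoid n} (hpx : p ∣ x) (hpy : p ∣ y)
    (hx : x ∣ m) (hx' : x ∣ m') (hy : y ∣ m) (hy' : y ∣ m') :
    ∃ z, x ∣ z ∧ y ∣ z ∧ z ∣ m ∧ z ∣ m' := by
  suffices ∀ L (p x y : BraidMonoid n), len m - len p ≤ L → p ∣ x → p ∣ y → x ∣ m → x ∣ m' →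
      y ∣ m → y ∣ m' → ∃ z, x ∣ z ∧ y ∣ z ∧ z ∣ m ∧ z ∣ m' from
    this _ p x y le_rfl hpx hpy hx hx' hy hy'
  clear! p x y
  intro L
  induction L with
  | zero =>
    intro p x y hL hpx hpy hx hx' hy hy'
    have hxp : x = p := by
      obtain ⟨w, rfl⟩ := hpx
      have := len_le_of_dvd hx
      rw [len_mul] at this
      rw [eq_one_of_len_eq_zero (x := w) (by omega), mul_one]
    exact ⟨y, hxp ▸ hpy, dvd_rfl, hy, hy'⟩
  | succ L ih =>
    rintro p _ _ hL ⟨x, rfl⟩ ⟨y, rfl⟩ hx hx' hy hy'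
    rcases eq_one_or_sigma_mul x with rfl | ⟨i, x, rfl⟩
    · exact ⟨p * y, by simp, dvd_rfl, hy, hy'⟩
    rcases eq_one_or_sigma_mul y with rfl | ⟨j, y, rfl⟩
    · exact ⟨_, dvd_rfl, by simp, hx, hx'⟩
    rw [← mul_assoc] at hx hx' hy hy' ⊢
    rw [← mul_assoc]
    have hi := (Dvd.intro _ rfl : p * sigma n i ∣ p * sigma n i * x)
    have hj := (Dvd.intro _ rfl : p * sigma n j ∣ p * sigma n j * y)
    have hq := mul_sigma_mul_comp_dvd (hi.trans hx) (hj.trans hy)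
    have hq' := mul_sigma_mul_comp_dvd (hi.trans hx') (hj.trans hy')
    -- Join `p σ_i x` with the lcm of `p σ_i` and `p σ_j` over the longer base `p σ_i`; then join
    -- the result with `p σ_j y` over `p σ_j`.
    obtain ⟨z, hz₁, hz₂, hz, hz'⟩ := ih (p * sigma n i) _ _ (by simp; omega) hi
      (Dvd.intro (comp i j) (mul_assoc _ _ _)) hx hx' hq hq'
    have hjz : p * sigma n j ∣ z :=
      (Dvd.intro (comp j i) (by rw [sigma_mul_comp, mul_assoc])).trans hz₂
    obtain ⟨z', h₁, h₂, hz, hz'⟩ := ih (p * sigma n j) _ _ (by simp; omega) hjz hj hz hz' hy hy'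
    exact ⟨z', hz₁.trans h₁, h₂, hz, hz'⟩

/-! ### Permutations, inversions and reduced braids -/

/-- The permutation of the strands (numbered from `0`, acting on all of `ℕ`) induced by a braid. -/
def perm (n : ℕ) : BraidMonoid n →* Equiv.Perm ℕ :=
  PresentedMonoid.lift (fun i : Fin (n - 1) => Equiv.swap (i : ℕ) (i + 1)) (by
    intro a b h
    cases h with
    | far i j h =>
      rw [← far_iff_abs] at h
      unfold Far at h
      ext k
      simp only [map_mul, FreeMonoid.lift_eval_of, Equiv.Perm.mul_apply, Equiv.swap_apply_def]
      grind
    | near i j h =>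
      rw [← near_iff_abs] at h
      unfold Near at h
      ext k
      simp only [map_mul, FreeMonoid.lift_eval_of, Equiv.Perm.mul_apply, Equiv.swap_apply_def]
      grind)

@[simp] theorem perm_sigma (i : Fin (n - 1)) :
    perm n (sigma n i) = Equiv.swap (i : ℕ) (i + 1) := rfl

theorem perm_mul_sigma_left (x : BraidMonoid n) (i : Fin (n - 1)) :
    perm n (x * sigma n i) i = perm n x (i + 1) := by simp

theorem perm_mul_sigma_right (x : BraidMonoid n) (i : Fin (n - 1)) :
    perm n (x * sigma n i) (i + 1) = perm n x i := by simp

theorem perm_mul_sigma_of_ne (x : BraidMonoid n) {i : Fin (n - 1)} {k : ℕ} (h : k ≠ i)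
    (h' : k ≠ i + 1) : perm n (x * sigma n i) k = perm n x k := by
  simp [Equiv.swap_apply_of_ne_of_ne h h']

/-- The inversions of a permutation among the first `N` natural numbers. -/
def inversions (N : ℕ) (τ : Equiv.Perm ℕ) : Finset (ℕ × ℕ) :=
  (Finset.range N ×ˢ Finset.range N).filter fun p => p.1 < p.2 ∧ τ p.2 < τ p.1

theorem mem_inversions {N : ℕ} {τ : Equiv.Perm ℕ} {p : ℕ × ℕ} :
    p ∈ inversions N τ ↔ p.1 < p.2 ∧ p.2 < N ∧ τ p.2 < τ p.1 := by
  simp only [inversions, Finset.mem_filter, Finset.mem_product, Finset.mem_range]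
  omega

/-- Exchanging the positions `i` and `i + 1` carries the old inversions to the new ones other than
`(i, i + 1)`. -/
theorem card_inversions_mul_swap_of_lt {N i : ℕ} {τ : Equiv.Perm ℕ} (hi : i + 1 < N)
    (h : τ i < τ (i + 1)) :
    (inversions N (τ * Equiv.swap i (i + 1))).card = (inversions N τ).card + 1 := by
  have heq : inversions N (τ * Equiv.swap i (i + 1)) = insert (i, i + 1)
      ((inversions N τ).map ((Equiv.swap i (i + 1)).prodCongr
        (Equiv.swap i (i + 1))).toEmbedding) := by
    ext ⟨a, b⟩
    rw [Finset.mem_insert, Finset.mem_map_equiv]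
    simp only [mem_inversions, Equiv.Perm.mul_apply, Equiv.prodCongr_symm, Equiv.symm_swap,
      Equiv.prodCongr_apply, Prod.map, Equiv.swap_apply_def, Prod.mk.injEq]
    grind
  rw [heq, Finset.card_insert_of_notMem, Finset.card_map]
  rw [Finset.mem_map_equiv]
  simp [mem_inversions]

theorem card_inversions_mul_swap_of_gt {N i : ℕ} {τ : Equiv.Perm ℕ} (hi : i + 1 < N)
    (h : τ (i + 1) < τ i) :
    (inversions N (τ * Equiv.swap i (i + 1))).card + 1 = (inversions N τ).card := by
  have := card_inversions_mul_swap_of_lt (τ := τ * Equiv.swap i (i + 1)) hi (by simpa using h)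
  rw [mul_assoc, Equiv.swap_mul_self, mul_one] at this
  exact this.symm

/-- The number of inversions of the permutation induced by a braid. -/
def inv (x : BraidMonoid n) : ℕ := (inversions (n - 1 + 1) (perm n x)).card

@[simp] theorem inv_one : inv (1 : BraidMonoid n) = 0 := by
  rw [inv, Finset.card_eq_zero, Finset.eq_empty_iff_forall_notMem]
  rintro p hp
  rw [mem_inversions] at hp
  simp at hp
  omega

theorem perm_lt_or_gt (x : BraidMonoid n) (i : ℕ) :
    perm n x i < perm n x (i + 1) ∨ perm n x (i + 1) < perm n x i :=
  lt_or_gt_of_ne ((perm n x).injective.ne (Nat.succ_ne_self i).symm)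

theorem inv_mul_sigma_of_lt {x : BraidMonoid n} {i : Fin (n - 1)}
    (h : perm n x i < perm n x (i + 1)) : inv (x * sigma n i) = inv x + 1 := by
  rw [inv, map_mul]
  exact card_inversions_mul_swap_of_lt (i := (i : ℕ)) (τ := perm n x) (by omega) h

theorem inv_mul_sigma_of_gt {x : BraidMonoid n} {i : Fin (n - 1)}
    (h : perm n x (i + 1) < perm n x i) : inv (x * sigma n i) + 1 = inv x := by
  rw [inv, map_mul]
  exact card_inversions_mul_swap_of_gt (i := (i : ℕ)) (τ := perm n x) (by omega) h

theorem inv_le_len (x : BraidMonoid n) : inv x ≤ len x := by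
  induction x using induction_mul_sigma with
  | one => simp
  | mul_sigma x i ih =>
    rw [len_mul, len_sigma]
    rcases perm_lt_or_gt x i with h | h
    · rw [inv_mul_sigma_of_lt h]
      omega
    · have := inv_mul_sigma_of_gt h
      omega

/-- A braid is reduced if its length is the number of inversions of its permutation. -/
def Reduced (x : BraidMonoid n) : Prop := inv x = len x

theorem reduced_one : Reduced (1 : BraidMonoid n) := by simp [Reduced]

theorem reduced_mul_sigma_iff {x : BraidMonoid n} {i : Fin (n - 1)} :
    Reduced (x * sigma n i) ↔ Reduced x ∧ perm n x i < perm n x (i + 1) := by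
  have hx := inv_le_len x
  unfold Reduced
  rw [len_mul, len_sigma]
  rcases perm_lt_or_gt x i with h | h
  · rw [inv_mul_sigma_of_lt h]
    simp [h]
  · have := inv_mul_sigma_of_gt h
    constructor <;> intro <;> omega

/-- The exchange property: a right descent of the permutation of a reduced braid is the index of a
right divisor. -/
theorem Reduced.exists_eq_mul_sigma {x : BraidMonoid n} (hx : Reduced x) {i : Fin (n - 1)}
    (hi : perm n x (i + 1) < perm n x i) : ∃ y, x = y * sigma n i := by
  suffices ∀ L (x : BraidMonoid n), len x ≤ L → Reduced x → ∀ i : Fin (n - 1),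
      perm n x (i + 1) < perm n x i → ∃ y, x = y * sigma n i from
    this _ x le_rfl hx i hi
  clear! x i
  intro L
  induction L with
  | zero =>
    intro x hx _ i hi
    rw [eq_one_of_len_eq_zero (Nat.le_zero.1 hx)] at hi
    simp at hi
  | succ L ih =>
    intro x hL hx i hi
    rcases eq_one_or_mul_sigma x with rfl | ⟨x, j, rfl⟩
    · simp at hi
    rw [len_mul, len_sigma] at hL
    rw [reduced_mul_sigma_iff] at hx
    obtain ⟨hx, hj⟩ := hx
    rcases eq_or_near_or_far i j with rfl | h | h
    · exact ⟨x, rfl⟩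
    -- The permutation of `x σ_j` reverses three consecutive positions, so `x σ_j` ends in `σ_j σ_i
    -- σ_j = σ_i σ_j σ_i`.
    · have hxi : perm n x (i + 1) < perm n x i := by
        rcases h with h | h
        · rw [h, perm_mul_sigma_left, perm_mul_sigma_of_ne _ (by omega) (by omega)] at hi
          rw [h]
          omega
        · rw [← h, perm_mul_sigma_right, perm_mul_sigma_of_ne _ (by omega) (by omega)] at hi
          rw [← h]
          omega
      obtain ⟨y, rfl⟩ := ih x (by omega) hx i hxi
      rw [len_mul, len_sigma] at hL
      have hyj : perm n y (j + 1) < perm n y j := by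
        simp only [map_mul, Equiv.Perm.mul_apply, perm_sigma, Equiv.swap_apply_def] at hi
        unfold Near at h
        grind
      obtain ⟨z, rfl⟩ := ih y (by omega) (reduced_mul_sigma_iff.1 hx).1 j hyj
      exact ⟨z * sigma n i * sigma n j, by
        simp only [mul_assoc, sigma_mul_sigma_mul_sigma_of_near h]⟩
    · have h' := h
      unfold Far at h'
      rw [perm_mul_sigma_of_ne _ (by omega) (by omega),
        perm_mul_sigma_of_ne _ (by omega) (by omega)] at hi
      obtain ⟨y, rfl⟩ := ih x (by omega) hx i hi
      exact ⟨y * sigma n j, by rw [mul_assoc, mul_assoc, sigma_mul_sigma_of_far h]⟩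

theorem Reduced.of_mul_left {x y : BraidMonoid n} (h : Reduced (x * y)) : Reduced x := by
  induction y using induction_mul_sigma with
  | one => simpa using h
  | mul_sigma y i ih =>
    rw [← mul_assoc, reduced_mul_sigma_iff] at h
    exact ih h.1

theorem not_reduced_mul_sigma_mul_sigma (x : BraidMonoid n) (i : Fin (n - 1)) :
    ¬ Reduced (x * sigma n i * sigma n i) := by
  rw [reduced_mul_sigma_iff, reduced_mul_sigma_iff, perm_mul_sigma_left, perm_mul_sigma_right]
  omega

/-- If the permutation of `y` had a descent at `i`, the exchange property would make `y` end in
`σ_i`, and `x y σ_i` would end in a square. -/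
theorem Reduced.of_mul_right {x y : BraidMonoid n} (h : Reduced (x * y)) : Reduced y := by
  induction y using induction_mul_sigma with
  | one => exact reduced_one
  | mul_sigma y i ih =>
    rw [← mul_assoc] at h
    have hy := ih (reduced_mul_sigma_iff.1 h).1
    refine reduced_mul_sigma_iff.2 ⟨hy, ?_⟩
    rcases perm_lt_or_gt y i with hi | hi
    · exact hi
    · obtain ⟨z, rfl⟩ := hy.exists_eq_mul_sigma hi
      rw [← mul_assoc] at h
      exact absurd h (not_reduced_mul_sigma_mul_sigma _ i)

/-- A reduced braid is determined by its permutation. -/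
theorem Reduced.eq_of_perm_eq {x y : BraidMonoid n} (hx : Reduced x) (hy : Reduced y)
    (h : perm n x = perm n y) : x = y := by
  induction x using induction_mul_sigma generalizing y with
  | one =>
    have : inv y = 0 := by rw [inv, ← h]; exact inv_one
    exact (eq_one_of_len_eq_zero (hy.symm.trans this)).symm
  | mul_sigma x i ih =>
    rw [reduced_mul_sigma_iff] at hx
    obtain ⟨z, rfl⟩ := hy.exists_eq_mul_sigma (i := i) (by
      rw [← h, perm_mul_sigma_left, perm_mul_sigma_right]; exact hx.2)
    rw [map_mul, map_mul] at h
    rw [ih hx.1 (reduced_mul_sigma_iff.1 hy).1 (mul_right_cancel h)]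

theorem perm_apply_of_le (x : BraidMonoid n) {k : ℕ} (hk : n - 1 < k) : perm n x k = k := by
  induction x using induction_mul_sigma with
  | one => simp
  | mul_sigma x i ih => rw [perm_mul_sigma_of_ne _ (by omega) (by omega), ih]

theorem perm_apply_le (x : BraidMonoid n) {k : ℕ} (hk : k ≤ n - 1) : perm n x k ≤ n - 1 := by
  by_contra! h
  have := (perm n x).injective (perm_apply_of_le x h)
  omega

/-! ### Simple braids are the reduced braids -/

theorem prod_map_swap_range_apply (m k : ℕ) :
    ((List.range m).map fun i => Equiv.swap i (i + 1)).prod k =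
      if k < m then k + 1 else if k = m then 0 else k := by
  induction m generalizing k with
  | zero => simp
  | succ m ih =>
    rw [List.range_succ, List.map_append, List.prod_append, Equiv.Perm.mul_apply, ih]
    simp only [List.map_cons, List.map_nil, List.prod_singleton, Equiv.swap_apply_def]
    grind

/-- The shorter word reverses `0, …, m` and fixes `m + 1`; the cycle then raises each of `0, …, m`
by one and sends `m + 1` to `0`. -/
theorem lift_swap_deltaWord_apply (m k : ℕ) :
    FreeMonoid.lift (fun i : Fin m => Equiv.swap (i : ℕ) (i + 1)) (deltaWord m) k =
      if k ≤ m then m - k else k := by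
  induction m generalizing k with
  | zero => simp [deltaWord]
  | succ m ih =>
    have h₁ : FreeMonoid.lift (fun i : Fin (m + 1) => Equiv.swap (i : ℕ) (i + 1))
        (FreeMonoid.ofList (List.finRange (m + 1))) =
        ((List.range (m + 1)).map fun i => Equiv.swap i (i + 1)).prod := by
      rw [FreeMonoid.lift_apply, FreeMonoid.toList_ofList, ← List.map_coe_finRange_eq_range,
        List.map_map]
      rfl
    have h₂ : FreeMonoid.lift (fun i : Fin (m + 1) => Equiv.swap (i : ℕ) (i + 1))
        (FreeMonoid.map Fin.castSucc (deltaWord m)) =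
        FreeMonoid.lift (fun i : Fin m => Equiv.swap (i : ℕ) (i + 1)) (deltaWord m) := by
      rw [FreeMonoid.lift_apply, FreeMonoid.lift_apply, FreeMonoid.toList_map, List.map_map]
      rfl
    rw [deltaWord, map_mul, Equiv.Perm.mul_apply, h₁, h₂, ih, prod_map_swap_range_apply]
    grind

theorem perm_delta_apply {k : ℕ} (hk : k ≤ n - 1) : perm n (delta n) k = n - 1 - k :=
  (lift_swap_deltaWord_apply (n - 1) k).trans (if_pos hk)

theorem length_deltaWord (m : ℕ) : (deltaWord m).toList.length * 2 = (m + 1) * m := by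
  induction m with
  | zero => rfl
  | succ m ih =>
    rw [deltaWord, FreeMonoid.toList_mul, FreeMonoid.toList_ofList, FreeMonoid.toList_map,
      List.length_append, List.length_map, List.length_finRange, add_mul, ih]
    ring

theorem card_inversions_of_decreasing {N : ℕ} {τ : Equiv.Perm ℕ}
    (h : ∀ a b, a < b → b < N → τ b < τ a) : (inversions N τ).card * 2 = N * (N - 1) := by
  rw [← Finset.sum_range_id_mul_two]
  congr 1
  trans ((Finset.range N).sigma fun b => Finset.range b).card
  · refine Finset.card_nbij' (fun p => ⟨p.2, p.1⟩) (fun q => (q.2, q.1)) ?_ ?_ ?_ ?_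
    · rintro ⟨a, b⟩ hp
      simp only [Finset.mem_coe, mem_inversions] at hp
      simp [hp.1, hp.2.1]
    · rintro ⟨b, a⟩ hp
      simp only [Finset.mem_coe, Finset.mem_sigma, Finset.mem_range] at hp
      simp only [Finset.mem_coe, mem_inversions]
      exact ⟨hp.2, hp.1, h a b hp.2 hp.1⟩
    · intro _ _; rfl
    · intro _ _; rfl
  · simp

/-- Every pair of strands is inverted, and the word for Δ has one letter per pair. -/
theorem reduced_delta : Reduced (delta n) := by
  have h₁ := card_inversions_of_decreasing (N := n - 1 + 1) (τ := perm n (delta n)) (by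
    intro a b hab hb
    rw [perm_delta_apply (by omega), perm_delta_apply (by omega)]
    omega)
  have h₂ := length_deltaWord (n - 1)
  have h₃ : len (delta n) = (deltaWord (n - 1)).toList.length := by
    rw [len, delta, length_mk, toAdd_ofAdd]
  rw [Nat.add_sub_cancel] at h₁
  rw [Reduced, inv, h₃]
  omega

/-- By position `k` the value has dropped at least `k` from at most `m`, and at least `m - k` drops
are still to come. -/
theorem eq_sub_of_decreasing {m : ℕ} {f : ℕ → ℕ} (hf : ∀ k ≤ m, f k ≤ m)
    (hdec : ∀ k < m, f (k + 1) < f k) {k : ℕ} (hk : k ≤ m) : f k = m - k := by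
  have h₁ : ∀ k ≤ m, f k + k ≤ m := by
    intro k
    induction k with
    | zero => exact hf 0
    | succ k ih =>
      intro hk
      have := ih (by omega)
      have := hdec k hk
      omega
  have h₂ : ∀ j k, k + j = m → j ≤ f k := by
    intro j
    induction j with
    | zero => intros; omega
    | succ j ih =>
      intro k hk
      have := ih (k + 1) (by omega)
      have := hdec k (by omega)
      omega
  have := h₁ k hk
  have := h₂ (m - k) k (by omega)
  omega

/-- Append generators at ascents as long as there are any. With no ascent left the permutation is
the reversal, and a reduced braid is determined by its permutation. -/
theorem Reduced.dvd_delta {x : BraidMonoid n} (hx : Reduced x) : x ∣ delta n := by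
  -- The square of the number of strands crudely bounds the inversions, so `L = 0` is contradictory.
  suffices ∀ L (x : BraidMonoid n), Reduced x → (n - 1 + 1) * (n - 1 + 1) < len x + L →
      x ∣ delta n from this ((n - 1 + 1) * (n - 1 + 1) + 1) x hx (by omega)
  clear! x
  intro L
  induction L with
  | zero =>
    intro x hx hL
    have : (inversions (n - 1 + 1) (perm n x)).card ≤ (n - 1 + 1) * (n - 1 + 1) := by
      simpa [inversions] using Finset.card_filter_le
        (Finset.range (n - 1 + 1) ×ˢ Finset.range (n - 1 + 1)) _
    rw [← hx] at hL
    exact absurd hL this.not_gt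
  | succ L ih =>
    intro x hx hL
    by_cases h : ∃ i : Fin (n - 1), perm n x i < perm n x (i + 1)
    · obtain ⟨i, hi⟩ := h
      exact (Dvd.intro _ rfl).trans
        (ih (x * sigma n i) (reduced_mul_sigma_iff.2 ⟨hx, hi⟩) (by simp; omega))
    · push Not at h
      suffices x = delta n by rw [this]
      refine hx.eq_of_perm_eq reduced_delta (Equiv.ext fun k => ?_)
      rcases le_or_gt k (n - 1) with hk | hk
      · rw [perm_delta_apply hk]
        exact eq_sub_of_decreasing (fun k => perm_apply_le x)
          (fun k hk => (perm_lt_or_gt x k).resolve_left (h ⟨k, hk⟩).not_gt) hk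
      · rw [perm_apply_of_le x hk, perm_apply_of_le _ hk]

theorem dvd_delta_iff_reduced {x : BraidMonoid n} : x ∣ delta n ↔ Reduced x := by
  refine ⟨?_, Reduced.dvd_delta⟩
  rintro ⟨y, h⟩
  exact Reduced.of_mul_left (h ▸ reduced_delta)

/-! ### Greedy factors and normal sequences -/

theorem isLeftGcd_delta_self_iff {x : BraidMonoid n} :
    IsLeftGcd x (delta n) x ↔ x ∣ delta n :=
  ⟨fun h => h.1, fun h => ⟨h, dvd_rfl, fun _ _ h => h⟩⟩

/-- The first factor of a product of two factors is greedy if and only if it absorbs all the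
initial generators of the second factor. -/
theorem isLeftGcd_mul_iff {x y : BraidMonoid n} (hx : x ∣ delta n) :
    IsLeftGcd x (delta n) (x * y) ↔ ∀ i, sigma n i ∣ y → RightDvd (sigma n i) x := by
  constructor
  · rintro ⟨-, -, h⟩ i hi
    rw [dvd_delta_iff_reduced] at hx
    rcases perm_lt_or_gt x i with hlt | hgt
    -- At an ascent, `x σ_i` would be a longer simple divisor of `x y`.
    · have := len_le_of_dvd (h _ (reduced_mul_sigma_iff.2 ⟨hx, hlt⟩).dvd_delta
        (mul_dvd_mul_left x hi))
      simp at this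
    · exact hx.exists_eq_mul_sigma hgt
  · intro h
    refine ⟨hx, Dvd.intro _ rfl, fun z hz hz' => ?_⟩
    -- The join of `x` and `z` is some `x w`. If `w` begins with `σ_i`, then `σ_i` divides `y`, so
    -- `x` ends in `σ_i` and the simple braid `x w` contains a square.
    obtain ⟨_, ⟨w, rfl⟩, hzw, hw, hw'⟩ :=
      exists_join (one_dvd x) (one_dvd z) hx (Dvd.intro y rfl) hz hz'
    rcases eq_one_or_sigma_mul w with rfl | ⟨i, w, rfl⟩
    · simpa using hzw
    · rw [mul_dvd_mul_left_iff'] at hw'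
      obtain ⟨x, rfl⟩ := h i ((Dvd.intro w rfl).trans hw')
      rw [← mul_assoc, dvd_delta_iff_reduced] at hw
      exact absurd hw.of_mul_left (not_reduced_mul_sigma_mul_sigma x i)

/-- Joining a simple divisor of `x m` with `x` gives a simple `x w`. Its right factor `w` is again
simple, so `w` divides `y`, and `x w` is a simple divisor of `x y`. -/
theorem IsLeftGcd.mul_of_mul {x y m : BraidMonoid n} (hy : IsLeftGcd y (delta n) m)
    (h : IsLeftGcd x (delta n) (x * y)) : IsLeftGcd x (delta n) (x * m) := by
  refine ⟨h.1, Dvd.intro _ rfl, fun z hz hz' => ?_⟩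
  obtain ⟨_, ⟨w, rfl⟩, hzw, hw, hw'⟩ :=
    exists_join (one_dvd x) (one_dvd z) h.1 (Dvd.intro m rfl) hz hz'
  have hws : w ∣ delta n := (dvd_delta_iff_reduced.1 hw).of_mul_right.dvd_delta
  have hwy := hy.2.2 w hws (mul_dvd_mul_left_iff'.1 hw')
  exact hzw.trans (h.2.2 _ hw (mul_dvd_mul_left x hwy))

theorem isLeftGcd_mul_congr {x y m : BraidMonoid n} (hy : IsLeftGcd y (delta n) m) :
    IsLeftGcd x (delta n) (x * m) ↔ IsLeftGcd x (delta n) (x * y) :=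
  ⟨fun h => ⟨h.1, Dvd.intro _ rfl,
    fun z hz hz' => h.2.2 z hz (hz'.trans (mul_dvd_mul_left x hy.2.1))⟩, hy.mul_of_mul⟩

theorem IsLeftGcd.unique {g g' x y : BraidMonoid n} (h : IsLeftGcd g x y)
    (h' : IsLeftGcd g' x y) : g = g' :=
  dvd_antisymm' (h'.2.2 g h.1 h.2.1) (h.2.2 g' h'.1 h'.2.1)

theorem isNormal_nil : IsNormal ([] : List (BraidMonoid n)) := fun k hk => by simp at hk

theorem isNormal_cons {x : BraidMonoid n} {l : List (BraidMonoid n)} :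
    IsNormal (x :: l) ↔ IsLeftGcd x (delta n) (x * l.prod) ∧ IsNormal l := by
  constructor
  · refine fun h => ⟨?_, fun k hk => h (k + 1) (Nat.succ_lt_succ hk)⟩
    rw [← List.prod_cons]
    exact h 0 (Nat.succ_pos _)
  · rintro ⟨h, hl⟩ (_ | k) hk
    · rw [List.drop_zero, List.prod_cons]
      exact h
    · exact hl k (Nat.lt_of_succ_lt_succ hk)

theorem isNormal_singleton {x : BraidMonoid n} : IsNormal [x] ↔ x ∣ delta n := by
  simp [isNormal_cons, isNormal_nil, isLeftGcd_delta_self_iff]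

theorem isNormal_pair {x y : BraidMonoid n} :
    IsNormal [x, y] ↔ IsLeftGcd x (delta n) (x * y) ∧ y ∣ delta n := by
  rw [isNormal_cons, isNormal_singleton, List.prod_singleton]

/-- Normality is local, so normal sequences are the paths of the graph with incidence matrix `M n`.
-/
theorem isNormal_cons_cons {x y : BraidMonoid n} {l : List (BraidMonoid n)} :
    IsNormal (x :: y :: l) ↔ IsNormal [x, y] ∧ IsNormal (y :: l) := by
  rw [isNormal_cons, isNormal_pair, and_assoc]
  constructor
  · rintro ⟨h, hl⟩
    have hy := (isNormal_cons.1 hl).1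
    exact ⟨(isLeftGcd_mul_congr hy).1 (by simpa using h), hy.1, hl⟩
  · rintro ⟨h, -, hl⟩
    have hy := (isNormal_cons.1 hl).1
    exact ⟨by simpa using (isLeftGcd_mul_congr hy).2 h, hl⟩

theorem isNormal_map_val_iff {l : List (Simple n)} :
    IsNormal (l.map fun x => x.1) ↔ l.IsChain fun x y => IsNormal [x.1, y.1] := by
  induction l with
  | nil => simp [isNormal_nil]
  | cons x l ih =>
    cases l with
    | nil => simpa [isNormal_singleton] using x.2
    | cons y l =>
      rw [List.isChain_cons_cons, ← ih]
      exact isNormal_cons_cons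

theorem IsNormal.dvd_delta {l : List (BraidMonoid n)} (hl : IsNormal l) {x : BraidMonoid n}
    (hx : x ∈ l) : x ∣ delta n := by
  obtain ⟨k, hk, rfl⟩ := List.getElem_of_mem hx
  exact (hl k hk).1

theorem isNormal_append_one {l : List (BraidMonoid n)} : IsNormal (l ++ [1]) ↔ IsNormal l := by
  induction l with
  | nil => simp [isNormal_singleton, isNormal_nil]
  | cons x l ih => simp [isNormal_cons, ih]

/-- A normal sequence is determined by its length and its product. -/
theorem IsNormal.eq_of_prod_eq {l l' : List (BraidMonoid n)} (hl : IsNormal l) (hl' : IsNormal l')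
    (hlen : l.length = l'.length) (h : l.prod = l'.prod) : l = l' := by
  induction l generalizing l' with
  | nil => exact (List.length_eq_zero_iff.1 hlen.symm).symm
  | cons x l ih =>
    cases l' with
    | nil => simp at hlen
    | cons y l' =>
      rw [isNormal_cons] at hl hl'
      rw [List.prod_cons, List.prod_cons] at h
      obtain rfl := (h ▸ hl.1).unique hl'.1
      rw [ih hl.2 hl'.2 (by simpa using hlen) (mul_left_cancel' x h)]

theorem map_range_add {x : ℕ → BraidMonoid n} {r : ℕ} (hx : ∀ k, r ≤ k → x k = 1) (j : ℕ) :
    (IsNormal ((List.range (r + j)).map x) ↔ IsNormal ((List.range r).map x)) ∧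
      ((List.range (r + j)).map x).prod = ((List.range r).map x).prod := by
  induction j with
  | zero => simp
  | succ j ih =>
    rw [← add_assoc, List.range_succ, List.map_append, List.map_singleton, hx _ (by omega),
      isNormal_append_one, List.prod_append, List.prod_singleton, mul_one]
    exact ih

theorem HasNormalForm.of_degree_le {z : BraidMonoid n} {x : ℕ → BraidMonoid n} {d : ℕ}
    (h : HasNormalForm z x) (hd : ∀ k, d ≤ k → x k = 1) :
    IsNormal ((List.range d).map x) ∧ ((List.range d).map x).prod = z := by
  obtain ⟨r, hr, rfl, h⟩ := h
  -- Either of `r` and `d` may be larger; both truncations are compared with the one of length `r +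
  -- d`.
  obtain ⟨h₁, h₂⟩ := map_range_add h d
  obtain ⟨h₃, h₄⟩ := map_range_add hd r
  rw [add_comm] at h₃ h₄
  exact ⟨h₃.1 (h₁.2 hr), h₄.symm.trans h₂⟩

/-! ### Counting normal sequences by powers of `M n` -/

open Classical in
/-- The reversed tails `(x_{e}, …, x_1)` of the normal sequences `(x_1, …, x_e, y)` of simple
braids. -/
noncomputable def normalTails : ℕ → Simple n → Finset (List (Simple n))
  | 0, _ => {[]}
  | e + 1, y => (Finset.univ.filter fun x : Simple n => IsNormal [x.1, y.1]).biUnion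
      fun x => (normalTails e x).image (List.cons x)

theorem mem_normalTails {e : ℕ} {y : Simple n} {l : List (Simple n)} :
    l ∈ normalTails e y ↔
      l.length = e ∧ (y :: l).IsChain fun x y => IsNormal [y.1, x.1] := by
  induction e generalizing y l with
  | zero =>
    rw [normalTails, Finset.mem_singleton, List.length_eq_zero_iff]
    constructor
    · rintro rfl; simp
    · exact fun h => h.1
  | succ e ih =>
    cases l with
    | nil => simp [normalTails]
    | cons x l =>
      simp only [normalTails, Finset.mem_biUnion, Finset.mem_filter, Finset.mem_univ, true_and,
        Finset.mem_image, List.cons.injEq, ih, List.length_cons, Nat.add_right_cancel_iff,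
        List.isChain_cons_cons]
      constructor
      · rintro ⟨_, h, _, h', rfl, rfl⟩
        exact ⟨h'.1, h, h'.2⟩
      · rintro ⟨h, h', h''⟩
        exact ⟨x, h', l, ⟨h, h''⟩, rfl, rfl⟩

theorem card_normalTails_succ (e : ℕ) (y : Simple n) :
    ((normalTails (e + 1) y).card : ℤ) = ∑ x, ((normalTails e x).card : ℤ) * M n x y := by
  classical
  rw [normalTails, Finset.card_biUnion]
  · simp only [Finset.card_image_of_injective _ (List.cons_injective)]
    rw [Nat.cast_sum, Finset.sum_filter]
    simp [M]
  · intro x _ x' _ hne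
    rw [Function.onFun, Finset.disjoint_left]
    simp only [Finset.mem_image]
    rintro _ ⟨l, _, rfl⟩ ⟨l', _, h⟩
    exact hne (List.cons.inj h).1.symm

theorem card_normalTails (e : ℕ) (y : Simple n) :
    ((normalTails e y).card : ℤ) = Matrix.vecMul (fun _ => (1 : ℤ)) (M n ^ e) y := by
  induction e generalizing y with
  | zero => simp [normalTails]
  | succ e ih =>
    rw [card_normalTails_succ, pow_succ, ← Matrix.vecMul_vecMul]
    simp only [ih]
    rfl

theorem isNormal_map_reverse_iff {l : List (Simple n)} :
    IsNormal (l.reverse.map fun x => x.1) ↔ l.IsChain fun x y => IsNormal [y.1, x.1] := by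
  rw [isNormal_map_val_iff, List.isChain_reverse]

/-- A tail is sent to the product of its normal sequence. Padding with trivial factors gives
surjectivity, uniqueness of normal sequences injectivity. -/
theorem b_succ_eq_card (e : ℕ) (y : Simple n) : b n (e + 1) y = (normalTails e y).card := by
  rw [b, ← Set.ncard_coe_finset]
  have hset : {z : BraidMonoid n | ∃ x : ℕ → BraidMonoid n, HasNormalForm z x ∧
      (∀ k, e + 1 ≤ k → x k = 1) ∧ x (e + 1 - 1) = y.1} =
      (fun l : List (Simple n) => ((y :: l).reverse.map fun x => x.1).prod) ''
        (normalTails e y : Set (List (Simple n))) := by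
    ext z
    constructor
    · rintro ⟨x, hx, hd, hy⟩
      obtain ⟨hn, rfl⟩ := hx.of_degree_le hd
      have hs : ∀ k, x k ∣ delta n := by
        intro k
        rcases lt_or_ge k (e + 1) with hk | hk
        · exact hn.dvd_delta (List.mem_map_of_mem (List.mem_range.2 hk))
        · rw [hd k hk]
          exact one_dvd _
      let x' : ℕ → Simple n := fun k => ⟨x k, hs k⟩
      have hl : (y :: ((List.range e).map x').reverse).reverse.map (fun x => x.1) =
          (List.range (e + 1)).map x := by
        rw [List.reverse_cons, List.reverse_reverse, List.map_append, List.map_map,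
          List.range_succ, List.map_append, List.map_singleton, List.map_singleton, ← hy]
        rfl
      refine ⟨((List.range e).map x').reverse, ?_, by simp only [hl]⟩
      rw [Finset.mem_coe, mem_normalTails, ← isNormal_map_reverse_iff, hl]
      exact ⟨by simp, hn⟩
    · rintro ⟨l, hl, rfl⟩
      rw [Finset.mem_coe, mem_normalTails, ← isNormal_map_reverse_iff] at hl
      obtain ⟨rfl, hl⟩ := hl
      set L := (y :: l).reverse.map fun x => x.1 with hL
      have hlen : L.length = l.length + 1 := by simp [hL]
      have hmap : (List.range (l.length + 1)).map (fun k => L.getD k 1) = L := by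
        refine List.ext_getElem (by simp [hlen]) fun k _ h => ?_
        simp [h]
      have hone : ∀ k, l.length + 1 ≤ k → L.getD k 1 = 1 := fun k hk =>
        List.getD_eq_default _ _ (by omega)
      refine ⟨fun k => L.getD k 1, ⟨l.length + 1, ?_, ?_, hone⟩, hone, ?_⟩
      · rwa [hmap]
      · rw [hmap]
      · simp [hL]
  rw [hset]
  refine Set.InjOn.ncard_image fun l hl l' hl' h => ?_
  rw [Finset.mem_coe, mem_normalTails, ← isNormal_map_reverse_iff] at hl hl'
  have := hl.2.eq_of_prod_eq hl'.2 (by simp [hl.1, hl'.1]) h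
  exact (List.cons.inj (List.reverse_injective
    (List.map_injective_iff.2 Subtype.val_injective this))).2

/-! ### A lower bound for the number of simple braids -/

/-- The homomorphism that vanishes on the braids containing the generator `σ_k`, and takes the
value `1` elsewhere. -/
def avoids (k : Fin (n - 1)) : BraidMonoid n →* ℕ :=
  PresentedMonoid.lift (fun j : Fin (n - 1) => if j = k then 0 else 1) (by
    intro a b h
    cases h with
    | far i j h => simp [mul_comm]
    | near i j h =>
      simp only [map_mul, FreeMonoid.lift_eval_of]
      split_ifs <;> rfl)

@[simp] theorem avoids_sigma (k j : Fin (n - 1)) :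
    avoids k (sigma n j) = if j = k then 0 else 1 := rfl

/-- Generators of index below `i` fix every point above `i`, so appending `σ_i` happens at an
ascent. -/
theorem reduced_prod_of_pairwise_lt {l : List (Fin (n - 1))} (hl : l.Pairwise (· < ·)) :
    Reduced (l.map (sigma n)).prod ∧
      ∀ k : ℕ, (∀ i ∈ l, (i : ℕ) + 1 < k) → perm n (l.map (sigma n)).prod k = k := by
  induction l using List.reverseRecOn with
  | nil => simp [reduced_one]
  | append_singleton l i ih =>
    rw [List.pairwise_append] at hl
    obtain ⟨hred, hfix⟩ := ih hl.1
    have hlt : ∀ j ∈ l, (j : ℕ) < i := fun j hj => hl.2.2 j hj i (by simp)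
    rw [List.map_append, List.prod_append, List.map_singleton, List.prod_singleton]
    constructor
    · have hfix' : ∀ k : ℕ, (i : ℕ) < k → perm n (l.map (sigma n)).prod k = k := fun k hk =>
        hfix k fun j hj => by have := hlt j hj; omega
      refine reduced_mul_sigma_iff.2 ⟨hred, (perm_lt_or_gt _ _).resolve_right fun h => ?_⟩
      rw [hfix' _ (by omega)] at h
      have := (perm n (l.map (sigma n)).prod).injective
        (hfix' (perm n (l.map (sigma n)).prod i) (by omega))
      omega
    · intro k hk
      have := hk i (by simp)
      rw [perm_mul_sigma_of_ne _ (by omega) (by omega)]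
      exact hfix k fun j hj => hk j (by simp [hj])

/-- There are at least as many simple braids as sets of generators. -/
theorem card_finset_le_card_simple (n : ℕ) :
    Fintype.card (Finset (Fin (n - 1))) ≤ Fintype.card (Simple n) := by
  -- Multiply the generators in `I` in increasing order; the maps `avoids k` recover `I` from the
  -- product.
  let f : Finset (Fin (n - 1)) → Simple n := fun I =>
    ⟨(I.sort.map (sigma n)).prod,
      (reduced_prod_of_pairwise_lt (Finset.sortedLT_sort I).pairwise).1.dvd_delta⟩
  refine Fintype.card_le_of_injective f fun I J h => ?_
  have hf : ∀ (I : Finset (Fin (n - 1))) (k : Fin (n - 1)),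
      avoids k (f I).1 = 0 ↔ k ∈ I := by
    intro I k
    simp [f, map_list_prod, List.prod_eq_zero_iff]
  ext k
  rw [← hf, ← hf, h]

/-! ### Factorisation of the two matrices through sets of generators -/

open Classical in
/-- The matrix recording which sets of generators consist of right divisors of a simple braid. -/
noncomputable def rightIncidence (n : ℕ) : Matrix (Simple n) (Finset (Fin (n - 1))) ℤ :=
  Matrix.of fun x J => if J ⊆ DR x then 1 else 0

/-- The matrix recording the set of generators that are left divisors of a simple braid. -/
noncomputable def leftIncidence (n : ℕ) : Matrix (Finset (Fin (n - 1))) (Simple n) ℤ :=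
  Matrix.of fun I y => if DL y = I then 1 else 0

theorem isNormal_pair_iff_subset {x y : Simple n} : IsNormal [x.1, y.1] ↔ DL y ⊆ DR x := by
  rw [isNormal_pair, isLeftGcd_mul_iff x.2, and_iff_left y.2, Finset.subset_iff]
  simp [DL, DR]

theorem rightIncidence_mul_leftIncidence (n : ℕ) :
    rightIncidence n * leftIncidence n = M n := by
  ext x y
  simp [Matrix.mul_apply, rightIncidence, leftIncidence, M, isNormal_pair_iff_subset]

theorem leftIncidence_mul_rightIncidence (n : ℕ) :
    leftIncidence n * rightIncidence n = M' n := by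
  classical
  ext I J
  simp only [Matrix.mul_apply, rightIncidence, leftIncidence, M', a, Matrix.of_apply,
    Nat.card_eq_fintype_card, Fintype.card_subtype, ← ite_and, mul_ite, mul_one, mul_zero]
  rw [Finset.card_filter]
  push_cast
  refine Finset.sum_congr rfl fun x _ => ?_
  split_ifs <;> simp_all

theorem vecMul_one_leftIncidence (n : ℕ) :
    Matrix.vecMul (fun _ => (1 : ℤ)) (leftIncidence n) = fun _ => 1 := by
  ext y
  simp [Matrix.vecMul, dotProduct, leftIncidence]

/-- Iterates the associativity L(RL) = (LR)L. -/
theorem leftIncidence_mul_pow (n e : ℕ) :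
    leftIncidence n * M n ^ e = M' n ^ e * leftIncidence n := by
  induction e with
  | zero => simp
  | succ e ih =>
    rw [pow_succ, ← Matrix.mul_assoc, ih, pow_succ, Matrix.mul_assoc, Matrix.mul_assoc,
      ← rightIncidence_mul_leftIncidence, ← leftIncidence_mul_rightIncidence, Matrix.mul_assoc]

theorem vecMul_leftIncidence_apply (v : Finset (Fin (n - 1)) → ℤ) (y : Simple n) :
    Matrix.vecMul v (leftIncidence n) y = v (DL y) := by
  simp [Matrix.vecMul, dotProduct, leftIncidence]

end BraidMonoid

theorem lemma2p12 (n : ℕ) (hn : 1 ≤ n) :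
    (∃ k : ℕ, (BraidMonoid.M n).charpoly = Polynomial.X ^ k * (BraidMonoid.M' n).charpoly) ∧
    ∀ (d : ℕ), 1 ≤ d → ∀ (J : Finset (Fin (n - 1))) (y : BraidMonoid.Simple n),
      BraidMonoid.DL y = J →
        (BraidMonoid.b n d y : ℤ) =
          Matrix.vecMul (fun _ => (1 : ℤ)) (BraidMonoid.M' n ^ (d - 1)) J := by
  refine ⟨⟨Fintype.card (BraidMonoid.Simple n) - Fintype.card (Finset (Fin (n - 1))), ?_⟩, ?_⟩
  · rw [← BraidMonoid.rightIncidence_mul_leftIncidence,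
      ← BraidMonoid.leftIncidence_mul_rightIncidence]
    exact Matrix.charpoly_mul_comm_of_le _ _ (BraidMonoid.card_finset_le_card_simple n)
  · rintro (_ | e) hd J y rfl
    · omega
    -- The all-ones row over simple braids is the all-ones row over subsets times L; L then moves
    -- past the powers and evaluates at `DL y`.
    · rw [BraidMonoid.b_succ_eq_card, BraidMonoid.card_normalTails, Nat.add_sub_cancel,
        ← BraidMonoid.vecMul_one_leftIncidence, Matrix.vecMul_vecMul,
        BraidMonoid.leftIncidence_mul_pow, ← Matrix.vecMul_vecMul,
        BraidMonoid.vecMul_leftIncidence_apply]
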